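/- Let $V$ be the vector space over $\mathbb{Q}$ of all finitely supported sequences of rational numbers, and let $\mathcal{P}$ be the space of all pseudonorms (seminorms) on $V$ with the topology inherited from $\mathbb{R}^V$. Each $\mu\in\mathcal{P}$ extends uniquely to a pseudonorm on the real vector space $c_{00}$ of finitely supported real sequences; $X_\mu$ denotes the real Banach space obtained as the completion of the quotient of $(c_{00},\mu)$ by $\{x:\mu(x)=0\}$. Let $\mathcal{P}_\infty$ be the set of those $\mu\in\mathcal{P}$ for which $X_\mu$ is infinite-dimensional, with the topology inherited from $\mathcal{P}$. For a real Banach space $X$, a set $K\subseteq X^*$ and $\varepsilon>0$, let \[ s_\varepsilon(K)=\{x^*\in K : \operatorname{diam}(U\cap K)\ge\varepsilon \text{ for every } w^*\text{-open } U\ni x^*\}, \] where the diameter is taken in the dual norm, and put $s_\varepsilon^0(K)=K$, $s_\varepsilon^{\beta+1}(K)=s_\varepsilon(s_\varepsilon^\beta(K))$, and $s_\varepsilon^\beta(K)=\bigcap_{\gamma<\beta}s_\varepsilon^\gamma(K)$ for limit $\beta$. Let $Sz(X,\varepsilon)$ be the least ordinal $\beta$ with $s_\varepsilon^\beta(B_{X^*})=\emptyset$,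 and $\infty$ if there is no such ordinal, and let $Sz(X)=\sup_{\varepsilon>0}Sz(X,\varepsilon)$ be the Szlenk index of $X$. **Theorem.** For every countable ordinal $\alpha\ge 1$, the set \[ \{\mu\in\mathcal{P}_\infty : Sz(X_\mu)\le\omega^\alpha\} \] is a $\boldsymbol{\Pi}^0_{\omega^\alpha+1}$ set in $\mathcal{P}_\infty$. Here $\boldsymbol{\Sigma}^0_1$ is the class of open sets, $\boldsymbol{\Pi}^0_\xi$ is the class of complements of $\boldsymbol{\Sigma}^0_\xi$ sets, and for $1<\xi<\omega_1$ the class $\boldsymbol{\Sigma}^0_\xi$ consists of the countable unions of sets from $\bigcup_{1\le\eta<\xi}\boldsymbol{\Pi}^0_\eta$. -/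

import Mathlib

open scoped Topology

noncomputable section

namespace SzlenkBorel

/-! ### The Borel hierarchy -/

/-- `IsSigma0 ξ A`: the set `A` belongs to the additive Borel class `𝚺⁰_ξ`, `1 ≤ ξ`. The class
`𝚺⁰_1` consists of the open sets and, for `ξ > 1`, the class `𝚺⁰_ξ` consists of the countable
unions of sets whose complements lie in `𝚺⁰_η` for some `1 ≤ η < ξ`. -/
inductive IsSigma0 {T : Type*} [TopologicalSpace T] : Ordinal.{0} → Set T → Prop
  | of_isOpen (U : Set T) (hU : IsOpen U) : IsSigma0 1 U
  | iUnion (ξ : Ordinal.{0}) (hξ : 1 < ξ) (A : ℕ → Set T) (η : ℕ → Ordinal.{0})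
      (hη : ∀ n, 1 ≤ η n ∧ η n < ξ) (hA : ∀ n, IsSigma0 (η n) (A n)ᶜ) :
      IsSigma0 ξ (⋃ n, A n)

/-- `IsPi0 ξ A`: the set `A` belongs to the multiplicative Borel class `𝚷⁰_ξ`. -/
def IsPi0 {T : Type*} [TopologicalSpace T] (ξ : Ordinal.{0}) (A : Set T) : Prop :=
  IsSigma0 ξ Aᶜ

/-! ### Szlenk derivation and Szlenk index -/

section Szlenk

variable {X : Type*} [NormedAddCommGroup X] [NormedSpace ℝ X]

/-- The Szlenk derivative of `K ⊆ X*`: the points of `K` all of whose weak* open neighbourhoods `U`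
satisfy `diam (U ∩ K) ≥ ε`, the diameter being taken in the dual norm. -/
def szlenkDeriv (ε : ℝ) (K : Set (WeakDual ℝ X)) : Set (WeakDual ℝ X) :=
  {f | f ∈ K ∧ ∀ U : Set (WeakDual ℝ X), IsOpen U → f ∈ U →
    ENNReal.ofReal ε ≤ Metric.ediam (WeakDual.toStrongDual '' (U ∩ K))}

/-- The closed unit ball of the dual space, as a set of points of the dual with its weak*
topology. -/
def dualBall (X : Type*) [NormedAddCommGroup X] [NormedSpace ℝ X] : Set (WeakDual ℝ X) :=
  WeakDual.toStrongDual ⁻¹' Metric.closedBall (0 : StrongDual ℝ X) 1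

end Szlenk

/-- The transfinite iterates of the Szlenk derivation; intersections are taken at limits. -/
def szlenkIter.{u} {X : Type u} [NormedAddCommGroup X] [NormedSpace ℝ X] (ε : ℝ)
    (K : Set (WeakDual ℝ X)) (α : Ordinal.{u}) : Set (WeakDual ℝ X) :=
  Ordinal.limitRecOn α K (fun _ S => szlenkDeriv ε S)
    (fun o _ S => ⋂ (β : Ordinal.{u}) (h : β < o), S β h)

/-- `Sz(X, ε)`: the least `α` such that the `α`-th derivative of the dual ball is empty, and `⊤` if
there is none. -/
def szlenkIndexAt.{u} (X : Type u) [NormedAddCommGroup X] [NormedSpace ℝ X] (ε : ℝ) :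
    WithTop Ordinal.{u} :=
  ⨅ (α : Ordinal.{u}) (_ : szlenkIter ε (dualBall X) α = ∅), (α : WithTop Ordinal.{u})

/-- The Szlenk index `Sz(X) = sup_{ε > 0} Sz(X, ε)`, with values in the ordinals together with
`⊤ = ∞`. -/
def szlenkIndex.{u} (X : Type u) [NormedAddCommGroup X] [NormedSpace ℝ X] :
    WithTop Ordinal.{u} :=
  ⨆ (ε : ℝ) (_ : 0 < ε), szlenkIndexAt X ε

/-! ### The space of pseudonorms -/

/-- The rational vector space of finitely supported rational sequences. -/
abbrev V : Type := ℕ →₀ ℚ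

/-- The space `𝓟` of all pseudonorms on `V`. -/
abbrev Pseudonorm : Type := Seminorm ℚ V

/-- The topology on `𝓟` inherited from `ℝ^V`. -/
instance instTopologicalSpacePseudonorm : TopologicalSpace Pseudonorm :=
  TopologicalSpace.induced (fun (μ : Pseudonorm) (v : V) => μ v) inferInstance

/-- The inclusion of `V` into the space `c₀₀` of finitely supported real sequences. -/
def ratToReal : V →+ (ℕ →₀ ℝ) :=
  Finsupp.mapRange.addMonoidHom (Rat.castHom ℝ).toAddMonoidHom

theorem ratToReal_apply (v : V) (i : ℕ) : ratToReal v i = (v i : ℝ) := rfl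

theorem ratToReal_smul (r : ℚ) (v : V) : ratToReal (r • v) = (r : ℝ) • ratToReal v := by
  ext i
  simp [ratToReal_apply]

/-- The weighted `ℓ₁`-pseudonorm `x ↦ ∑ |x_i| μ(e_i)` on `c₀₀`. -/
def weightedL1 (μ : Pseudonorm) : Seminorm ℝ (ℕ →₀ ℝ) :=
  Seminorm.of (fun x => x.sum fun i a => |a| * μ (Finsupp.single i 1))
    (fun x y => by
      classical
      have key : ∀ z : ℕ →₀ ℝ, z.support ⊆ x.support ∪ y.support →
          (z.sum fun i a => |a| * μ (Finsupp.single i 1)) =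
            ∑ i ∈ x.support ∪ y.support, |z i| * μ (Finsupp.single i 1) :=
        fun z hz => Finsupp.sum_of_support_subset z hz _ (by simp)
      rw [key x Finset.subset_union_left, key y Finset.subset_union_right,
        key (x + y) Finsupp.support_add, ← Finset.sum_add_distrib]
      refine Finset.sum_le_sum fun i _ => ?_
      rw [← add_mul, Finsupp.add_apply]
      exact mul_le_mul_of_nonneg_right (abs_add_le _ _) (apply_nonneg μ _))
    (fun a x => by
      rw [Finsupp.sum_smul_index (by simp), Finsupp.sum, Finsupp.sum, Finset.mul_sum]
      refine Finset.sum_congr rfl fun i _ => ?_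
      rw [abs_mul, Real.norm_eq_abs, mul_assoc])

theorem le_weightedL1 (μ : Pseudonorm) (v : V) : μ v ≤ weightedL1 μ (ratToReal v) := by
  have h1 : μ v ≤ ∑ i ∈ v.support, μ (Finsupp.single i (v i)) := by
    conv_lhs => rw [← Finsupp.sum_single v]
    exact Finset.le_sum_of_subadditive μ (map_zero μ).le (map_add_le_add μ) _ _
  have h2 : weightedL1 μ (ratToReal v) =
      ∑ i ∈ v.support, |(v i : ℝ)| * μ (Finsupp.single i 1) :=
    Finsupp.sum_of_support_subset (ratToReal v)
      (fun i hi => by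
        rw [Finsupp.mem_support_iff] at hi ⊢
        exact fun h => hi (by rw [ratToReal_apply, h, Rat.cast_zero]))
      (fun i a => |a| * μ (Finsupp.single i 1)) (by simp)
  rw [h2]
  refine h1.trans (Finset.sum_le_sum fun i _ => ?_)
  rw [← Finsupp.smul_single_one, map_smul_eq_mul, ← Rat.norm_cast_real, Real.norm_eq_abs]

/-- The value at `x ∈ c₀₀` of the extension of `μ` to `c₀₀`. -/
def extendFun (μ : Pseudonorm) (x : ℕ →₀ ℝ) : ℝ :=
  ⨅ v : V, (μ v + weightedL1 μ (x - ratToReal v))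

theorem extendFun_le (μ : Pseudonorm) (x : ℕ →₀ ℝ) (v : V) :
    extendFun μ x ≤ μ v + weightedL1 μ (x - ratToReal v) :=
  ciInf_le ⟨0, by rintro _ ⟨w, rfl⟩; positivity⟩ v

theorem exists_lt_extendFun_add (μ : Pseudonorm) (x : ℕ →₀ ℝ) {ε : ℝ} (hε : 0 < ε) :
    ∃ v : V, μ v + weightedL1 μ (x - ratToReal v) < extendFun μ x + ε :=
  exists_lt_of_ciInf_lt (lt_add_of_pos_right _ hε)

theorem extendFun_ratToReal (μ : Pseudonorm) (v : V) : extendFun μ (ratToReal v) = μ v := by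
  apply le_antisymm
  · simpa using extendFun_le μ (ratToReal v) v
  · refine le_ciInf fun w => ?_
    have h1 : μ v ≤ μ w + μ (v - w) := by
      simpa using map_add_le_add μ w (v - w)
    have h2 := le_weightedL1 μ (v - w)
    rw [map_sub ratToReal] at h2
    linarith

/-- The extension of the pseudonorm `μ` on `V` to a pseudonorm on `c₀₀`. -/
def extend (μ : Pseudonorm) : Seminorm ℝ (ℕ →₀ ℝ) :=
  Seminorm.ofSMulLE (extendFun μ)
    (by simpa using extendFun_ratToReal μ 0)
    (fun x y => by
      refine le_of_forall_pos_le_add fun ε hε => ?_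
      obtain ⟨v, hv⟩ := exists_lt_extendFun_add μ x (half_pos hε)
      obtain ⟨w, hw⟩ := exists_lt_extendFun_add μ y (half_pos hε)
      have h1 := extendFun_le μ (x + y) (v + w)
      have h2 := map_add_le_add μ v w
      have h3 := map_add_le_add (weightedL1 μ) (x - ratToReal v) (y - ratToReal w)
      rw [map_add ratToReal, add_sub_add_comm] at h1
      linarith)
    (fun r x => by
      refine le_of_forall_pos_le_add fun ε hε => ?_
      obtain ⟨δ, hδ, hδε⟩ : ∃ δ : ℝ, 0 < δ ∧ |r| * δ ≤ ε / 2 := by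
        refine ⟨ε / 2 / (|r| + 1), by positivity, ?_⟩
        rw [mul_div_assoc', div_le_iff₀ (by positivity)]
        nlinarith [abs_nonneg r]
      obtain ⟨v, hv⟩ := exists_lt_extendFun_add μ x hδ
      set c := μ v + weightedL1 μ (ratToReal v) with hc
      have hc0 : 0 ≤ c := by positivity
      obtain ⟨s, hs1, hs2⟩ := exists_rat_btwn (show r < r + ε / 2 / (c + 1) by
        have : 0 < ε / 2 / (c + 1) := by positivity
        linarith)
      have hsr : |(s : ℝ) - r| * c ≤ ε / 2 := by
        rw [abs_of_pos (by linarith)]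
        have h : (s : ℝ) - r ≤ ε / 2 / (c + 1) := by linarith
        calc ((s : ℝ) - r) * c ≤ ε / 2 / (c + 1) * (c + 1) := by
              apply mul_le_mul h (by linarith) hc0 (by positivity)
          _ = ε / 2 := by field_simp
      have h1 := extendFun_le μ (r • x) (s • v)
      have h2 : μ (s • v) ≤ |r| * μ v + |(s : ℝ) - r| * μ v := by
        rw [map_smul_eq_mul, ← add_mul]
        refine mul_le_mul_of_nonneg_right ?_ (apply_nonneg μ v)
        have := abs_add_le r ((s : ℝ) - r)
        simpa [← Rat.norm_cast_real] using this
      have h3 : weightedL1 μ (r • x - ratToReal (s • v)) ≤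
          |r| * weightedL1 μ (x - ratToReal v) +
            |(s : ℝ) - r| * weightedL1 μ (ratToReal v) := by
        have e : r • x - ratToReal (s • v) =
            r • (x - ratToReal v) - ((s : ℝ) - r) • ratToReal v := by
          rw [ratToReal_smul]
          module
        rw [e]
        refine (map_sub_le_add _ _ _).trans ?_
        rw [map_smul_eq_mul, map_smul_eq_mul, Real.norm_eq_abs, Real.norm_eq_abs]
      have h4 := mul_le_mul_of_nonneg_left hv.le (abs_nonneg r)
      rw [hc] at hsr
      rw [Real.norm_eq_abs]
      nlinarith)

/-- `extend μ` extends `μ`. -/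
theorem extend_ratToReal (μ : Pseudonorm) (v : V) : extend μ (ratToReal v) = μ v :=
  extendFun_ratToReal μ v

theorem exists_weightedL1_sub_lt (μ : Pseudonorm) (x : ℕ →₀ ℝ) {ε : ℝ} (hε : 0 < ε) :
    ∃ v : V, weightedL1 μ (x - ratToReal v) < ε := by
  induction x using Finsupp.induction_linear generalizing ε with
  | zero => exact ⟨0, by simpa using hε⟩
  | add f g hf hg =>
    obtain ⟨v, hv⟩ := hf (half_pos hε)
    obtain ⟨w, hw⟩ := hg (half_pos hε)
    refine ⟨v + w, ?_⟩
    rw [map_add ratToReal, add_sub_add_comm]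
    have := map_add_le_add (weightedL1 μ) (f - ratToReal v) (g - ratToReal w)
    linarith
  | single i a =>
    have hc : 0 ≤ weightedL1 μ (Finsupp.single i 1) := by positivity
    obtain ⟨s, hs1, hs2⟩ := exists_rat_btwn
      (show a < a + ε / (weightedL1 μ (Finsupp.single i 1) + 1) by
        have : 0 < ε / (weightedL1 μ (Finsupp.single i 1) + 1) := by positivity
        linarith)
    refine ⟨Finsupp.single i s, ?_⟩
    have e : Finsupp.single i a - ratToReal (Finsupp.single i s) =
        (a - s) • Finsupp.single i (1 : ℝ) := by
      simp [ratToReal]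
    rw [e, map_smul_eq_mul, Real.norm_eq_abs, abs_of_neg (by linarith)]
    have h : -(a - s) < ε / (weightedL1 μ (Finsupp.single i 1) + 1) := by linarith
    rw [lt_div_iff₀ (by positivity)] at h
    nlinarith

/-- `extend μ` is the only pseudonorm on `c₀₀` that extends `μ`. -/
theorem eq_extend (μ : Pseudonorm) (p : Seminorm ℝ (ℕ →₀ ℝ)) (hp : ∀ v, p (ratToReal v) = μ v) :
    p = extend μ := by
  have hq : ∀ x, p x ≤ weightedL1 μ x := fun x => by
    have h1 : p x ≤ ∑ i ∈ x.support, p (Finsupp.single i (x i)) := by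
      conv_lhs => rw [← Finsupp.sum_single x]
      exact Finset.le_sum_of_subadditive p (map_zero p).le (map_add_le_add p) _ _
    refine h1.trans (Finset.sum_le_sum fun i _ => ?_)
    have h2 : p (Finsupp.single i 1) = μ (Finsupp.single i 1) := by
      rw [← hp]
      simp [ratToReal]
    rw [← Finsupp.smul_single_one, map_smul_eq_mul, Real.norm_eq_abs, h2]
  ext x
  apply le_antisymm
  · refine le_ciInf fun v => ?_
    have h1 := map_add_le_add p (ratToReal v) (x - ratToReal v)
    rw [add_sub_cancel, hp] at h1
    linarith [hq (x - ratToReal v)]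
  · refine le_of_forall_pos_le_add fun ε hε => ?_
    obtain ⟨v, hv⟩ := exists_weightedL1_sub_lt μ x (half_pos hε)
    have h1 : extend μ x ≤ μ v + weightedL1 μ (x - ratToReal v) := extendFun_le μ x v
    have h2 := map_sub_le_add p x (x - ratToReal v)
    rw [sub_sub_cancel, hp] at h2
    linarith [hq (x - ratToReal v)]

/-- The space `c₀₀`, to be equipped with the pseudonorm `extend μ`. -/
def C00 (_ : Pseudonorm) : Type := ℕ →₀ ℝ

instance (μ : Pseudonorm) : AddCommGroup (C00 μ) :=
  inferInstanceAs (AddCommGroup (ℕ →₀ ℝ))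

instance (μ : Pseudonorm) : Module ℝ (C00 μ) :=
  inferInstanceAs (Module ℝ (ℕ →₀ ℝ))

instance (μ : Pseudonorm) : SeminormedAddCommGroup (C00 μ) :=
  AddGroupSeminorm.toSeminormedAddCommGroup (extend μ).toAddGroupSeminorm

instance (μ : Pseudonorm) : NormedSpace ℝ (C00 μ) where
  norm_smul_le a x := (map_smul_eq_mul (extend μ) a x).le

/-- The Banach space `X_μ`: the completion of the quotient of `c₀₀`, with the pseudonorm `extend μ`,
by the subspace of vectors of pseudonorm zero. -/
abbrev codedSpace (μ : Pseudonorm) : Type :=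
  UniformSpace.Completion (SeparationQuotient (C00 μ))

/-- The space `𝓟_∞` of those `μ` for which `X_μ` is infinite-dimensional, with the topology
inherited from `𝓟`. -/
abbrev PInfty : Type := {μ : Pseudonorm // ¬ FiniteDimensional ℝ (codedSpace μ)}

end SzlenkBorel

end

open scoped Topology

noncomputable section

namespace SzlenkBorel

/-! ### Closure properties of the Borel hierarchy -/

section Borel

variable {T : Type*} [TopologicalSpace T]

/-! Fix `ε`. Weak* compactness of the dual ball shows that its derivative of limit order `ω ^ α` is
empty iff some derivative of order `β < ω ^ α` is. So the condition on `μ` is: for each `n` there is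
`β < ω ^ α` such that the `β`-th derivative with `ε = 1 / (n + 1)` is empty. If each of these
countably many conditions has Borel class below `ω ^ α`, the union over `β` is `𝚺⁰_{ω ^ α}` and the
intersection over `n` is `𝚷⁰_{ω ^ α + 1}`.

The class is bounded by induction on `β`, for a statement stronger than emptiness: for all open `U ⊆
ℝ^V` at once, the set of `μ` whose `β`-th derivative, viewed in `ℝ^V` by evaluation on `V`, lies in
`U`. For `β = 0` it is open (`isOpen_setOf_dualBall_subset`). At limits, compactness makes it a
countable union of earlier sets. At successors, compactness replaces the derivative by a finite
cover by basic open sets of small diameter, and smallness of diameter is expressed by countably many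
conditions on the previous derivative (`derivSubset_add_one`). Each successor step costs finitely
many levels, at most 18, and `18 * (β + 1) < ω ^ α` whenever `β < ω ^ α`. -/

theorem IsSigma0.one_le {ξ : Ordinal.{0}} {A : Set T} (h : IsSigma0 ξ A) : 1 ≤ ξ := by
  cases h with
  | of_isOpen => exact le_rfl
  | iUnion _ hξ => exact hξ.le

theorem IsSigma0.preimage {S : Type*} [TopologicalSpace S] {f : S → T} (hf : Continuous f)
    {ξ : Ordinal.{0}} {A : Set T} (h : IsSigma0 ξ A) : IsSigma0 ξ (f ⁻¹' A) := by
  induction h with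
  | of_isOpen U hU => exact .of_isOpen _ (hU.preimage hf)
  | iUnion ξ hξ A η hη _ ih =>
    rw [Set.preimage_iUnion]
    exact .iUnion ξ hξ _ η hη ih

/-- That open sets are `F_σ` makes the hierarchy increasing, and later turns avoidance of an open
set into countably many containments in open sets. -/
theorem exists_iUnion_isClosed_of_isOpen
    [TopologicalSpace.PseudoMetrizableSpace T] {U : Set T} (hU : IsOpen U) :
    ∃ F : ℕ → Set T, (∀ n, IsClosed (F n)) ∧ ⋃ n, F n = U := by
  let := TopologicalSpace.pseudoMetrizableSpacePseudoMetric T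
  obtain ⟨F, hF, -, hFU, -⟩ := IsOpen.exists_iUnion_isClosed hU
  exact ⟨F, hF, hFU⟩

theorem IsSigma0.compl {ξ : Ordinal.{0}} {A : Set T} (h : IsSigma0 ξ A) :
    IsSigma0 (ξ + 1) Aᶜ := by
  have hlt : ξ < ξ + 1 := Order.lt_add_one_iff.2 le_rfl
  rw [← Set.iUnion_const (ι := ℕ) Aᶜ]
  exact .iUnion _ (h.one_le.trans_lt hlt) _ (fun _ => ξ) (fun _ => ⟨h.one_le, hlt⟩)
    fun _ => by rwa [compl_compl]

/-- `IsDelta0 ξ A`: the set `A` belongs to the ambiguous Borel class `𝚫⁰_ξ`. -/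
def IsDelta0 (ξ : Ordinal.{0}) (A : Set T) : Prop :=
  IsSigma0 ξ A ∧ IsSigma0 ξ Aᶜ

theorem IsDelta0.compl {ξ : Ordinal.{0}} {A : Set T} (h : IsDelta0 ξ A) : IsDelta0 ξ Aᶜ :=
  ⟨h.2, by rw [compl_compl]; exact h.1⟩

variable [TopologicalSpace.PseudoMetrizableSpace T]

theorem IsSigma0.mono {ξ η : Ordinal.{0}} {A : Set T} (h : IsSigma0 η A) (hηξ : η ≤ ξ) :
    IsSigma0 ξ A := by
  cases h with
  | of_isOpen _ hU =>
    rcases hηξ.eq_or_lt with rfl | hlt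
    · exact .of_isOpen _ hU
    · obtain ⟨F, hF, rfl⟩ := exists_iUnion_isClosed_of_isOpen hU
      exact .iUnion ξ hlt F (fun _ => 1) (fun _ => ⟨le_rfl, hlt⟩)
        fun n => .of_isOpen _ (hF n).isOpen_compl
  | iUnion _ hη A ζ hζ hA =>
    exact .iUnion ξ (hη.trans_le hηξ) A ζ (fun n => ⟨(hζ n).1, (hζ n).2.trans_le hηξ⟩) hA

theorem IsSigma0.iUnion_of_countable {ι : Type*} [Countable ι] {ξ : Ordinal.{0}} (hξ : 1 < ξ)
    {A : ι → Set T} (hA : ∀ i, ∃ η < ξ, IsSigma0 η (A i)ᶜ) : IsSigma0 ξ (⋃ i, A i) := by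
  cases isEmpty_or_nonempty ι
  · rw [Set.iUnion_of_empty]
    exact (IsSigma0.of_isOpen _ isOpen_empty).mono hξ.le
  · obtain ⟨e, he⟩ := exists_surjective_nat ι
    choose η hη hs using hA
    rw [← he.iUnion_comp]
    exact .iUnion ξ hξ _ (fun n => η (e n)) (fun n => ⟨(hs _).one_le, hη _⟩) fun n => hs _

theorem IsDelta0.mono {ξ η : Ordinal.{0}} {A : Set T} (h : IsDelta0 η A) (hηξ : η ≤ ξ) :
    IsDelta0 ξ A :=
  ⟨h.1.mono hηξ, h.2.mono hηξ⟩

theorem IsDelta0.of_isOpen {ξ : Ordinal.{0}} (hξ : 2 ≤ ξ) {U : Set T} (hU : IsOpen U) :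
    IsDelta0 ξ U := by
  have h : IsSigma0 1 U := .of_isOpen U hU
  exact ⟨h.mono (one_le_two.trans hξ), h.compl.mono (by rwa [one_add_one_eq_two])⟩

/-- The union is `𝚺⁰_{ξ+1}`, hence ambiguous one level higher. Working only with ambiguous classes
is wasteful, but gives every countable operation the same cost 2. -/
theorem IsDelta0.iUnion {ι : Type*} [Countable ι] {ξ : Ordinal.{0}} (hξ : 1 ≤ ξ) {A : ι → Set T}
    (hA : ∀ i, IsDelta0 ξ (A i)) : IsDelta0 (ξ + 2) (⋃ i, A i) := by
  have hlt : ξ < ξ + 1 := Order.lt_add_one_iff.2 le_rfl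
  have e : ξ + 2 = ξ + 1 + 1 := by rw [add_assoc, one_add_one_eq_two]
  have h : IsSigma0 (ξ + 1) (⋃ i, A i) :=
    .iUnion_of_countable (hξ.trans_lt hlt) fun i => ⟨ξ, hlt, (hA i).2⟩
  rw [e]
  exact ⟨h.mono (Order.lt_add_one_iff.2 le_rfl).le, h.compl⟩

theorem IsDelta0.iInter {ι : Type*} [Countable ι] {ξ : Ordinal.{0}} (hξ : 1 ≤ ξ) {A : ι → Set T}
    (hA : ∀ i, IsDelta0 ξ (A i)) : IsDelta0 (ξ + 2) (⋂ i, A i) := by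
  rw [← compl_compl (⋂ i, A i), Set.compl_iInter]
  exact (IsDelta0.iUnion hξ fun i => (hA i).compl).compl

theorem IsDelta0.union {ξ : Ordinal.{0}} {A B : Set T} (hA : IsDelta0 ξ A) (hB : IsDelta0 ξ B) :
    IsDelta0 (ξ + 2) (A ∪ B) := by
  rw [Set.union_eq_iUnion]
  exact .iUnion hA.1.one_le (Bool.forall_bool.2 ⟨hB, hA⟩)

theorem IsDelta0.inter {ξ : Ordinal.{0}} {A B : Set T} (hA : IsDelta0 ξ A) (hB : IsDelta0 ξ B) :
    IsDelta0 (ξ + 2) (A ∩ B) := by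
  rw [Set.inter_eq_iInter]
  exact .iInter hA.1.one_le (Bool.forall_bool.2 ⟨hB, hA⟩)

end Borel

/-! ### Szlenk derivatives -/

section Szlenk

universe u

variable {X : Type u} [NormedAddCommGroup X] [NormedSpace ℝ X] {ε : ℝ} {K : Set (WeakDual ℝ X)}

theorem szlenkDeriv_subset : szlenkDeriv ε K ⊆ K := fun _ h => h.1

theorem szlenkDeriv_mono {ε' : ℝ} {L : Set (WeakDual ℝ X)} (hε : ε ≤ ε') (hKL : K ⊆ L) :
    szlenkDeriv ε' K ⊆ szlenkDeriv ε L := fun _ hf =>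
  ⟨hKL hf.1, fun U hU hfU => (ENNReal.ofReal_le_ofReal hε).trans <| (hf.2 U hU hfU).trans <|
    Metric.ediam_mono (Set.image_mono (Set.inter_subset_inter_right U hKL))⟩

theorem isClosed_szlenkDeriv (hK : IsClosed K) : IsClosed (szlenkDeriv ε K) := by
  have e : szlenkDeriv ε K = K ∩ ⋂ U : {U : Set (WeakDual ℝ X) // IsOpen U ∧
      Metric.ediam (WeakDual.toStrongDual '' (U ∩ K)) < ENNReal.ofReal ε}, U.1ᶜ := by
    ext f
    simp only [szlenkDeriv, Set.mem_ofPred_eq, Set.mem_inter_iff, Set.mem_iInter,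
      Set.mem_compl_iff, Subtype.forall]
    refine and_congr_right fun _ => forall_congr' fun U => ?_
    rw [← not_lt]
    tauto
  rw [e]
  exact hK.inter (isClosed_iInter fun U => U.2.1.isClosed_compl)

theorem isCompact_dualBall : IsCompact (dualBall X) :=
  WeakDual.isCompact_closedBall 0 1

theorem szlenkIter_zero : szlenkIter ε K 0 = K :=
  Ordinal.limitRecOn_zero ..

theorem szlenkIter_add_one (α : Ordinal.{u}) :
    szlenkIter ε K (α + 1) = szlenkDeriv ε (szlenkIter ε K α) :=
  Ordinal.limitRecOn_add_one ..

theorem szlenkIter_limit {α : Ordinal.{u}} (hα : Order.IsSuccLimit α) :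
    szlenkIter ε K α = ⋂ β < α, szlenkIter ε K β :=
  Ordinal.limitRecOn_limit _ _ _ _ hα

theorem isClosed_szlenkIter (hK : IsClosed K) (α : Ordinal.{u}) :
    IsClosed (szlenkIter ε K α) := by
  induction α using Ordinal.limitRecOn with
  | zero => rwa [szlenkIter_zero]
  | add_one α ih => rw [szlenkIter_add_one]; exact isClosed_szlenkDeriv ih
  | limit α hα ih => rw [szlenkIter_limit hα]; exact isClosed_biInter ih

theorem szlenkIter_antitone : Antitone (szlenkIter ε K) := by
  intro β α h
  induction α using Ordinal.limitRecOn with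
  | zero => rw [nonpos_iff_eq_zero.1 h]
  | add_one α ih =>
    rcases h.eq_or_lt with rfl | h
    · exact le_rfl
    · rw [szlenkIter_add_one]
      exact szlenkDeriv_subset.trans (ih (Order.lt_add_one_iff.1 h))
  | limit α hα ih =>
    rcases h.eq_or_lt with rfl | h
    · exact le_rfl
    · rw [szlenkIter_limit hα]
      exact Set.biInter_subset_of_mem h

theorem szlenkIter_subset (α : Ordinal.{u}) : szlenkIter ε K α ⊆ K := by
  simpa only [szlenkIter_zero] using szlenkIter_antitone (ε := ε) (K := K) (zero_le (a := α))

theorem szlenkIter_anti_eps {ε' : ℝ} (hε : ε ≤ ε') (α : Ordinal.{u}) :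
    szlenkIter ε' K α ⊆ szlenkIter ε K α := by
  induction α using Ordinal.limitRecOn with
  | zero => rw [szlenkIter_zero, szlenkIter_zero]
  | add_one α ih => rw [szlenkIter_add_one, szlenkIter_add_one]; exact szlenkDeriv_mono hε ih
  | limit α hα ih => rw [szlenkIter_limit hα, szlenkIter_limit hα]; exact Set.iInter₂_mono ih

/-- A decreasing family of compact sets whose intersection lies in an open set has a member in that
set. -/
theorem szlenkIter_limit_subset_iff (hK : IsCompact K) {α : Ordinal.{u}}
    (hα : Order.IsSuccLimit α) {O : Set (WeakDual ℝ X)} (hO : IsOpen O) :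
    szlenkIter ε K α ⊆ O ↔ ∃ β < α, szlenkIter ε K β ⊆ O := by
  refine ⟨fun h => ?_, fun ⟨β, hβ, h⟩ => (szlenkIter_antitone hβ.le).trans h⟩
  have hc := fun β => isClosed_szlenkIter (ε := ε) hK.isClosed β
  have : Nonempty (Set.Iio α) := ⟨⟨0, hα.bot_lt⟩⟩
  rw [szlenkIter_limit hα] at h
  replace h : ⋂ β : Set.Iio α, szlenkIter ε K β ⊆ O := by rwa [Set.iInter_subtype]
  obtain ⟨β, hβ⟩ := exists_subset_nhds_of_isCompact' (V := fun β : Set.Iio α => szlenkIter ε K β)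
    (directed_of_isDirected_le fun _ _ h => szlenkIter_antitone h)
    (fun β => hK.of_isClosed_subset (hc β) (szlenkIter_subset _)) (fun β => hc β)
    (fun x hx => hO.mem_nhds (h hx))
  exact ⟨β, β.2, hβ⟩

theorem szlenkIndexAt_le_iff {α : Ordinal.{u}} :
    szlenkIndexAt X ε ≤ (α : WithTop Ordinal.{u}) ↔ szlenkIter ε (dualBall X) α = ∅ := by
  refine ⟨fun h => ?_, fun h => iInf₂_le α h⟩
  by_contra hne
  have h1 : ((α + 1 : Ordinal.{u}) : WithTop Ordinal.{u}) ≤ szlenkIndexAt X ε := by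
    refine le_iInf₂ fun β hβ => WithTop.coe_le_coe.2 (Order.add_one_le_of_lt ?_)
    by_contra! hle
    exact hne (Set.subset_empty_iff.1 (hβ ▸ szlenkIter_antitone hle))
  exact (Order.lt_add_one_iff.2 le_rfl).not_ge (WithTop.coe_le_coe.1 (h1.trans h))

theorem szlenkIndex_le_limit_iff {α : Ordinal.{u}} (hα : Order.IsSuccLimit α) :
    szlenkIndex X ≤ (α : WithTop Ordinal.{u}) ↔
      ∀ n : ℕ, ∃ β < α, szlenkIter (1 / (n + 1)) (dualBall X) β = ∅ := by
  have key (ε : ℝ) : szlenkIter ε (dualBall X) α = ∅ ↔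
      ∃ β < α, szlenkIter ε (dualBall X) β = ∅ := by
    simpa only [Set.subset_empty_iff] using
      szlenkIter_limit_subset_iff isCompact_dualBall hα isOpen_empty
  simp only [szlenkIndex, iSup_le_iff, szlenkIndexAt_le_iff, ← key]
  refine ⟨fun h n => h _ Nat.one_div_pos_of_nat, fun h ε hε => ?_⟩
  obtain ⟨n, hn⟩ := exists_nat_one_div_lt hε
  exact Set.subset_empty_iff.1 (h n ▸ szlenkIter_anti_eps hn.le α)

end Szlenk

/-! ### The dual ball of the coded space -/

section Coded

variable (μ : Pseudonorm)

/-- The canonical map from `c₀₀` to `X_μ`. -/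
def toCoded : C00 μ →L[ℝ] codedSpace μ :=
  UniformSpace.Completion.toComplL.comp (SeparationQuotient.mkCLM ℝ (C00 μ))

theorem isUniformInducing_toCoded : IsUniformInducing (toCoded μ) :=
  (UniformSpace.Completion.isUniformInducing_coe _).comp
    SeparationQuotient.isUniformInducing_mk

theorem denseRange_toCoded : DenseRange (toCoded μ) :=
  UniformSpace.Completion.denseRange_coe.comp SeparationQuotient.surjective_mk.denseRange
    (UniformSpace.Completion.continuous_coe _)

theorem norm_toCoded (x : C00 μ) : ‖toCoded μ x‖ = ‖x‖ :=
  (UniformSpace.Completion.norm_coe _).trans (SeparationQuotient.norm_mk x)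

/-- The canonical map from `V` to `X_μ`. -/
def ratToCoded : V →+ codedSpace μ :=
  (toCoded μ : C00 μ →+ codedSpace μ).comp (show V →+ C00 μ from ratToReal)

theorem ratToCoded_smul (r : ℚ) (v : V) : ratToCoded μ (r • v) = (r : ℝ) • ratToCoded μ v := by
  change toCoded μ (ratToReal (r • v)) = (r : ℝ) • toCoded μ (ratToReal v)
  rw [ratToReal_smul]
  exact map_smul (toCoded μ) (r : ℝ) (show C00 μ from ratToReal v)

theorem norm_ratToCoded (v : V) : ‖ratToCoded μ v‖ = μ v :=
  (norm_toCoded μ _).trans (extend_ratToReal μ v)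

theorem extend_le_weightedL1 (x : ℕ →₀ ℝ) : extend μ x ≤ weightedL1 μ x := by
  have h : extendFun μ x ≤ weightedL1 μ x := by simpa using extendFun_le μ x 0
  exact h

theorem denseRange_ratToCoded : DenseRange (ratToCoded μ) := by
  refine (denseRange_toCoded μ).comp (f := fun v : V => (show C00 μ from ratToReal v)) ?_
    (toCoded μ).continuous
  refine Metric.dense_iff.2 fun x ε hε => ?_
  obtain ⟨v, hv⟩ := exists_weightedL1_sub_lt μ x hε
  refine ⟨_, ?_, Set.mem_range_self v⟩
  rw [Metric.mem_ball', dist_eq_norm]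
  exact (extend_le_weightedL1 μ _).trans_lt hv

/-- Evaluation of the functionals on `X_μ` at the vectors from `V`. -/
def evalV (f : WeakDual ℝ (codedSpace μ)) (v : V) : ℝ := f (ratToCoded μ v)

theorem continuous_evalV : Continuous (evalV μ) :=
  continuous_pi fun v => WeakDual.eval_continuous (ratToCoded μ v)

theorem evalV_injective : Function.Injective (evalV μ) := fun f g h =>
  DFunLike.coe_injective <| (denseRange_ratToCoded μ).equalizer f.continuous g.continuous h

/-- The evaluation is an embedding of the dual ball. -/
theorem exists_isOpen_preimage_evalV {O : Set (WeakDual ℝ (codedSpace μ))} (hO : IsOpen O)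
    {f : WeakDual ℝ (codedSpace μ)} (hf : f ∈ O) :
    ∃ W ∈ TopologicalSpace.countableBasis (V → ℝ), f ∈ evalV μ ⁻¹' W ∧
      evalV μ ⁻¹' W ∩ dualBall (codedSpace μ) ⊆ O := by
  -- An injective continuous map sends the compact set `dualBall \ O` to a closed set missing `evalV
  -- μ f`, so a basic neighbourhood can avoid it.
  have hC : IsClosed (evalV μ '' (dualBall (codedSpace μ) \ O)) :=
    ((isCompact_dualBall.diff hO).image (continuous_evalV μ)).isClosed
  obtain ⟨W, hW, hfW, hWC⟩ :=
    (TopologicalSpace.isBasis_countableBasis (V → ℝ)).exists_subset_of_mem_open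
      (a := evalV μ f) (u := (evalV μ '' (dualBall (codedSpace μ) \ O))ᶜ)
      (by rintro ⟨g, hg, hgf⟩; exact hg.2 (evalV_injective μ hgf ▸ hf)) hC.isOpen_compl
  refine ⟨W, hW, hfW, fun g hg => ?_⟩
  by_contra hgO
  exact hWC hg.1 ⟨g, ⟨hg.2, hgO⟩, rfl⟩

/-- Rational vectors are dense, and `v` is rescaled by a rational slightly larger than `μ v`, which
also covers `μ v = 0`. A one-sided bound suffices because `-v` is tested too. -/
theorem norm_le_of_forall_ratToCoded (h : StrongDual ℝ (codedSpace μ)) {δ : ℝ} (hδ : 0 ≤ δ)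
    (hh : ∀ v, μ v ≤ 1 → h (ratToCoded μ v) ≤ δ) : ‖h‖ ≤ δ := by
  have key (v : V) : h (ratToCoded μ v) ≤ δ * μ v := by
    refine le_of_forall_pos_le_add fun ε hε => ?_
    obtain ⟨r, hr1, hr2⟩ := exists_rat_btwn (show μ v < μ v + ε / (δ + 1) by
      have : 0 < ε / (δ + 1) := by positivity
      linarith)
    have hr : 0 < (r : ℝ) := (apply_nonneg μ v).trans_lt hr1
    have h1 := hh (r⁻¹ • v) (by
      rw [map_smul_eq_mul, ← Rat.norm_cast_real, Rat.cast_inv, norm_inv, Real.norm_eq_abs,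
        abs_of_pos hr]
      exact (inv_mul_le_one₀ hr).2 hr1.le)
    rw [ratToCoded_smul, map_smul, smul_eq_mul, Rat.cast_inv, inv_mul_le_iff₀ hr] at h1
    have h2 : δ * (ε / (δ + 1)) ≤ ε := by
      rw [mul_div_assoc', div_le_iff₀ (by positivity)]
      nlinarith
    nlinarith
  refine h.opNorm_le_bound hδ fun x => ?_
  induction x using (denseRange_ratToCoded μ).induction_on with
  | hp => exact isClosed_le (by fun_prop) (by fun_prop)
  | ih v =>
    rw [norm_ratToCoded, Real.norm_eq_abs, abs_le']
    refine ⟨key v, ?_⟩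
    simpa using key (-v)

/-- A rational `δ` below `ε` turns the strict inequality into a countable union of closed
conditions, tested on the countable set `V`. -/
theorem ediam_lt_iff {S : Set (WeakDual ℝ (codedSpace μ))} {ε : ℝ} :
    Metric.ediam (WeakDual.toStrongDual '' S) < ENNReal.ofReal ε ↔
      ∃ δ : {δ : ℚ // 0 ≤ δ ∧ (δ : ℝ) < ε}, ∀ v, μ v ≤ 1 →
        ∀ f ∈ S, ∀ g ∈ S, evalV μ f v - evalV μ g v ≤ δ.1 := by
  constructor
  · intro h
    obtain ⟨δ, hδ0, hδ1, hδ2⟩ := ENNReal.lt_iff_exists_rat_btwn.1 h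
    have hδε : (δ : ℝ) < ε := (ENNReal.ofReal_lt_ofReal_iff'.1 hδ2).1
    refine ⟨⟨δ, hδ0, hδε⟩, fun v hv f hf g hg => ?_⟩
    have h1 := (Metric.edist_le_ediam_of_mem (Set.mem_image_of_mem WeakDual.toStrongDual hf)
      (Set.mem_image_of_mem _ hg)).trans hδ1.le
    rw [edist_dist] at h1
    have h2 := (ENNReal.ofReal_le_ofReal_iff (by exact_mod_cast hδ0)).1 h1
    rw [dist_eq_norm] at h2
    have h3 := (WeakDual.toStrongDual f - WeakDual.toStrongDual g).le_opNorm (ratToCoded μ v)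
    rw [norm_ratToCoded] at h3
    have h4 : evalV μ f v - evalV μ g v ≤
        ‖(WeakDual.toStrongDual f - WeakDual.toStrongDual g) (ratToCoded μ v)‖ := le_abs_self _
    have h5 := mul_le_mul h2 hv (apply_nonneg μ v) (by exact_mod_cast hδ0)
    linarith
  · rintro ⟨⟨δ, hδ0, hδε⟩, h⟩
    have hδ0' : (0 : ℝ) ≤ δ := by exact_mod_cast hδ0
    refine (Metric.ediam_le ?_).trans_lt ((ENNReal.ofReal_lt_ofReal_iff_of_nonneg hδ0').2 hδε)
    rintro _ ⟨f, hf, rfl⟩ _ ⟨g, hg, rfl⟩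
    rw [edist_dist, dist_eq_norm]
    exact ENNReal.ofReal_le_ofReal
      (norm_le_of_forall_ratToCoded μ _ hδ0' fun v hv => h v hv f hf g hg)

/-- With `abs_evalV_le`, this identifies the dual ball with the additive functions on `V` dominated
by `μ`, a description in which only `μ` varies and not the space. -/
theorem exists_evalV_eq {φ : V → ℝ} (hadd : ∀ v w, φ (v + w) = φ v + φ w)
    (hle : ∀ v, |φ v| ≤ μ v) : ∃ f ∈ dualBall (codedSpace μ), evalV μ f = φ := by
  let φ' : V →+ ℝ := AddMonoidHom.mk' φ hadd
  let L : (ℕ →₀ ℝ) →ₗ[ℝ] ℝ := Finsupp.lsum ℝ fun i =>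
    LinearMap.toSpanSingleton ℝ ℝ (φ (.single i 1))
  have hL (v : V) : L (ratToReal v) = φ v := by
    have : (L.toAddMonoidHom.comp ratToReal) = φ' := by
      refine Finsupp.addHom_ext fun i q => ?_
      have h := map_ratCast_smul φ' ℚ ℚ q (.single i 1)
      simp only [Rat.cast_id, Finsupp.smul_single_one] at h
      simpa [L, φ', ratToReal, Rat.smul_def] using h.symm
    exact DFunLike.congr_fun this v
  have hL1 (x : ℕ →₀ ℝ) : |L x| ≤ weightedL1 μ x := by
    have h1 : L x = x.sum fun i a => a * φ (.single i 1) := by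
      simp [L, Finsupp.sum]
    rw [h1]
    refine (Finset.abs_sum_le_sum_abs _ _).trans (Finset.sum_le_sum fun i _ => ?_)
    rw [abs_mul]
    exact mul_le_mul_of_nonneg_left (hle _) (abs_nonneg _)
  have hL2 (x : C00 μ) : ‖L x‖ ≤ 1 * ‖x‖ := by
    rw [one_mul]
    -- The norm on `C00 μ` is an infimum over `v`, so it is enough to bound `L x` by `|φ v|` plus
    -- the weighted `ℓ₁` error.
    refine le_ciInf fun v => ?_
    have h1 := hL1 ((show ℕ →₀ ℝ from x) - ratToReal v)
    rw [map_sub, hL] at h1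
    have h2 := abs_sub_abs_le_abs_sub (L x) (φ v)
    have h3 := hle v
    rw [Real.norm_eq_abs]
    linarith
  let M : C00 μ →L[ℝ] ℝ := LinearMap.mkContinuous (show C00 μ →ₗ[ℝ] ℝ from L) 1 hL2
  let F : StrongDual ℝ (codedSpace μ) := M.extend (toCoded μ)
  have hF (x : C00 μ) : F (toCoded μ x) = M x :=
    M.extend_eq (denseRange_toCoded μ) (isUniformInducing_toCoded μ) x
  refine ⟨StrongDual.toWeakDual F, ?_, ?_⟩
  · refine mem_closedBall_zero_iff.2 ?_
    refine F.opNorm_le_bound zero_le_one fun x => ?_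
    induction x using (denseRange_toCoded μ).induction_on with
    | hp => exact isClosed_le (by fun_prop) (by fun_prop)
    | ih x => rw [hF, norm_toCoded]; exact hL2 x
  · funext v
    exact (hF _).trans (hL v)

theorem abs_evalV_le {f : WeakDual ℝ (codedSpace μ)} (hf : f ∈ dualBall (codedSpace μ)) (v : V) :
    |evalV μ f v| ≤ μ v := by
  have h := (WeakDual.toStrongDual f).le_of_opNorm_le (mem_closedBall_zero_iff.1 hf)
    (ratToCoded μ v)
  rwa [one_mul, norm_ratToCoded] at h

end Coded

/-! ### Complexity of the Szlenk derivatives -/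

theorem continuous_coe_pseudonorm : Continuous fun (μ : Pseudonorm) (v : V) => μ v :=
  continuous_induced_dom

theorem continuous_apply_pseudonorm (v : V) : Continuous fun μ : Pseudonorm => μ v :=
  (continuous_apply v).comp continuous_coe_pseudonorm

instance : TopologicalSpace.PseudoMetrizableSpace Pseudonorm :=
  Topology.IsInducing.pseudoMetrizableSpace (f := fun (μ : Pseudonorm) (v : V) => μ v) ⟨rfl⟩

/-- The complement is closed: functionals outside `U` for `ν` near `μ` are pointwise bounded, so
they converge along an ultrafilter, and the limit is additive, dominated by `μ` and still outside
`U`. -/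
theorem isOpen_setOf_dualBall_subset {U : Set (V → ℝ)} (hU : IsOpen U) :
    IsOpen {μ : Pseudonorm | dualBall (codedSpace μ) ⊆ evalV μ ⁻¹' U} := by
  rw [← isClosed_compl_iff, isClosed_iff_ultrafilter]
  intro μ 𝓕 h𝓕 hmem
  have hex : ∀ᶠ ν in (𝓕 : Filter Pseudonorm), ∃ f ∈ dualBall (codedSpace ν), evalV ν f ∉ U :=
    Filter.mem_of_superset hmem fun ν hν => Set.not_subset.1 hν
  -- Where no witness exists `g ν` is arbitrary, so its bounds hold only eventually along `𝓕`.
  choose! g hg hgU using fun (ν : Pseudonorm)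
    (h : ∃ f ∈ dualBall (codedSpace ν), evalV ν f ∉ U) => h
  have hev (v : V) : Filter.Tendsto (fun ν : Pseudonorm => ν v) 𝓕 (𝓝 (μ v)) :=
    (continuous_apply_pseudonorm v).continuousAt.mono_left h𝓕
  have hlim (v : V) : ∃ y, Filter.Tendsto (fun ν => evalV ν (g ν) v) 𝓕 (𝓝 y) := by
    have h1 : ∀ᶠ ν in (𝓕 : Filter Pseudonorm),
        evalV ν (g ν) v ∈ Set.Icc (-(μ v + 1)) (μ v + 1) := by
      filter_upwards [hex, (hev v).eventually (gt_mem_nhds (lt_add_one _))] with ν h1 h2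
      exact abs_le.1 ((abs_evalV_le ν (hg ν h1) v).trans h2.le)
    obtain ⟨y, -, hy⟩ := isCompact_Icc.ultrafilter_le_nhds (𝓕.map fun ν => evalV ν (g ν) v)
      (Filter.le_principal_iff.2 h1)
    exact ⟨y, hy⟩
  choose φ hφ using hlim
  obtain ⟨f, hf, hfφ⟩ := exists_evalV_eq μ (φ := φ)
    (fun v w => tendsto_nhds_unique (hφ (v + w)) <| ((hφ v).add (hφ w)).congr fun ν => by
      simp [evalV])
    (fun v => le_of_tendsto_of_tendsto (hφ v).abs (hev v) <| by
      filter_upwards [hex] with ν hν using abs_evalV_le ν (hg ν hν) v)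
  refine Set.not_subset.2 ⟨f, hf, ?_⟩
  change evalV μ f ∉ U
  rw [hfφ]
  exact hU.isClosed_compl.mem_of_tendsto (tendsto_pi_nhds.2 hφ)
    (by filter_upwards [hex] with ν hν using hgU ν hν)

variable {μ : Pseudonorm} {ε : ℝ}

/-- The set of those `μ` for which the derivative of order `β` of the dual ball is contained in the
open set coded by `U`. -/
def derivSubset (ε : ℝ) (β : Ordinal.{0}) (U : Set (V → ℝ)) : Set Pseudonorm :=
  {μ | szlenkIter ε (dualBall (codedSpace μ)) β ⊆ evalV μ ⁻¹' U}

/-- The set of those `μ` for which the derivative of order `β` of the dual ball is disjoint from the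
set coded by `U`. -/
def derivDisjoint (ε : ℝ) (β : Ordinal.{0}) (U : Set (V → ℝ)) : Set Pseudonorm :=
  {μ | szlenkIter ε (dualBall (codedSpace μ)) β ⊆ (evalV μ ⁻¹' U)ᶜ}

/-- Points of `K` outside `U` are not in the derivative, so each has a basic neighbourhood of small
diameter in `K`; they form a compact set, so finitely many suffice. -/
theorem szlenkDeriv_subset_iff {K : Set (WeakDual ℝ (codedSpace μ))} (hK : IsClosed K)
    (hKB : K ⊆ dualBall (codedSpace μ)) {U : Set (V → ℝ)} (hU : IsOpen U) :
    szlenkDeriv ε K ⊆ evalV μ ⁻¹' U ↔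
      ∃ s : Finset (TopologicalSpace.countableBasis (V → ℝ)),
        K ⊆ evalV μ ⁻¹' (U ∪ ⋃ W ∈ s, W.1) ∧
        ∀ W ∈ s, Metric.ediam (WeakDual.toStrongDual '' (evalV μ ⁻¹' W.1 ∩ K)) <
          ENNReal.ofReal ε := by
  have hopen (W : TopologicalSpace.countableBasis (V → ℝ)) : IsOpen (evalV μ ⁻¹' W.1) :=
    (TopologicalSpace.isOpen_of_mem_countableBasis W.2).preimage (continuous_evalV μ)
  constructor
  · intro h
    have hcomp : IsCompact (K \ evalV μ ⁻¹' U) :=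
      (isCompact_dualBall.of_isClosed_subset hK hKB).diff (hU.preimage (continuous_evalV μ))
    have hloc : ∀ f ∈ K \ evalV μ ⁻¹' U, ∃ W : TopologicalSpace.countableBasis (V → ℝ),
        f ∈ evalV μ ⁻¹' W.1 ∧ Metric.ediam (WeakDual.toStrongDual '' (evalV μ ⁻¹' W.1 ∩ K)) <
          ENNReal.ofReal ε := by
      intro f hf
      have h1 : ∃ O, IsOpen O ∧ f ∈ O ∧
          Metric.ediam (WeakDual.toStrongDual '' (O ∩ K)) < ENNReal.ofReal ε := by
        by_contra! hne
        exact hf.2 (h ⟨hf.1, hne⟩)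
      obtain ⟨O, hO, hfO, hdiam⟩ := h1
      obtain ⟨W, hW, hfW, hWO⟩ := exists_isOpen_preimage_evalV μ hO hfO
      refine ⟨⟨W, hW⟩, hfW, (Metric.ediam_mono (Set.image_mono ?_)).trans_lt hdiam⟩
      exact fun g hg => ⟨hWO ⟨hg.1, hKB hg.2⟩, hg.2⟩
    have : Nonempty (TopologicalSpace.countableBasis (V → ℝ)) := by
      obtain ⟨W, hW, -⟩ :=
        (TopologicalSpace.isBasis_countableBasis (V → ℝ)).exists_subset_of_mem_open
          (Set.mem_univ 0) isOpen_univ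
      exact ⟨W, hW⟩
    choose! W hfW hdiam using hloc
    obtain ⟨t, ht, hcover⟩ := hcomp.elim_nhds_subcover (fun f => evalV μ ⁻¹' (W f).1)
      fun f hf => (hopen _).mem_nhds (hfW f hf)
    classical
    refine ⟨t.image W, fun f hf => ?_, ?_⟩
    · by_cases hfU : f ∈ evalV μ ⁻¹' U
      · exact Or.inl hfU
      · obtain ⟨g, hg, hfg⟩ := Set.mem_iUnion₂.1 (hcover ⟨hf, hfU⟩)
        exact Or.inr (Set.mem_iUnion₂.2 ⟨W g, Finset.mem_image_of_mem W hg, hfg⟩)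
    · intro W' hW'
      obtain ⟨g, hg, rfl⟩ := Finset.mem_image.1 hW'
      exact hdiam g (ht g hg)
  · rintro ⟨s, hcover, hdiam⟩ f hf
    rcases hcover hf.1 with hfU | hfW
    · exact hfU
    · obtain ⟨W, hW, hfW⟩ := Set.mem_iUnion₂.1 hfW
      exact absurd (hdiam W hW) (hf.2 _ (hopen W) hfW).not_gt

/-- The bound fails exactly when a rational `q` satisfies `evalV μ g v < q < evalV μ f v - δ`. This
decouples `f` from `g`, leaving conditions that `K` avoid an open set when `W` is open. -/
theorem forall_evalV_sub_le_iff {K : Set (WeakDual ℝ (codedSpace μ))} {W : Set (V → ℝ)} {v : V}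
    {δ : ℚ} : (∀ f ∈ evalV μ ⁻¹' W ∩ K, ∀ g ∈ evalV μ ⁻¹' W ∩ K, evalV μ f v - evalV μ g v ≤ δ) ↔
      ∀ q : ℚ, K ⊆ (evalV μ ⁻¹' (W ∩ {φ | (q + δ : ℝ) < φ v}))ᶜ ∨
        K ⊆ (evalV μ ⁻¹' (W ∩ {φ | φ v < q}))ᶜ := by
  constructor
  · intro h q
    by_contra! hne
    obtain ⟨f, hfK, hf⟩ := Set.not_subset.1 hne.1
    obtain ⟨g, hgK, hg⟩ := Set.not_subset.1 hne.2
    obtain ⟨hfW, hf⟩ := not_not.1 hf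
    obtain ⟨hgW, hg⟩ := not_not.1 hg
    have := h f ⟨hfW, hfK⟩ g ⟨hgW, hgK⟩
    change _ < evalV μ f v at hf
    change evalV μ g v < _ at hg
    linarith
  · intro h f hf g hg
    by_contra! hlt
    obtain ⟨q, hq1, hq2⟩ := exists_rat_btwn (show evalV μ g v < evalV μ f v - δ by linarith)
    rcases h q with h | h
    · exact h hf.2 ⟨hf.1, show (q + δ : ℝ) < evalV μ f v by linarith⟩
    · exact h hg.2 ⟨hg.1, hq1⟩

theorem derivSubset_add_one (β : Ordinal.{0}) {U : Set (V → ℝ)} (hU : IsOpen U) :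
    derivSubset ε (β + 1) U = ⋃ s : Finset (TopologicalSpace.countableBasis (V → ℝ)),
      derivSubset ε β (U ∪ ⋃ W ∈ s, W.1) ∩
      ⋂ W : s, ⋃ δ : {δ : ℚ // 0 ≤ δ ∧ (δ : ℝ) < ε}, ⋂ v : V,
        {μ : Pseudonorm | 1 < μ v} ∪ ⋂ q : ℚ,
          derivDisjoint ε β (W.1.1 ∩ {φ | (q + δ.1 : ℝ) < φ v}) ∪
          derivDisjoint ε β (W.1.1 ∩ {φ | φ v < q}) := by
  ext μ
  change szlenkIter ε (dualBall (codedSpace μ)) (β + 1) ⊆ _ ↔ _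
  rw [szlenkIter_add_one, szlenkDeriv_subset_iff
    (isClosed_szlenkIter isCompact_dualBall.isClosed β) (szlenkIter_subset β) hU]
  have h1 (v : V) (p : Prop) : 1 < μ v ∨ p ↔ (μ v ≤ 1 → p) := by
    rw [← not_le, imp_iff_not_or]
  simp only [ediam_lt_iff, forall_evalV_sub_le_iff]
  simp only [Set.mem_iUnion, Set.mem_inter_iff,
    Set.mem_iInter, Set.mem_union, derivSubset, derivDisjoint, Set.mem_ofPred_eq, Subtype.forall,
    h1]

theorem IsDelta0.derivDisjoint {ξ : Ordinal.{0}} {β : Ordinal.{0}} (hξ : 1 ≤ ξ)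
    (h : ∀ U : Set (V → ℝ), IsOpen U → IsDelta0 ξ (derivSubset ε β U)) {U : Set (V → ℝ)}
    (hU : IsOpen U) : IsDelta0 (ξ + 2) (derivDisjoint ε β U) := by
  obtain ⟨F, hF, rfl⟩ := exists_iUnion_isClosed_of_isOpen hU
  have e : SzlenkBorel.derivDisjoint ε β (⋃ n, F n) = ⋂ n, derivSubset ε β (F n)ᶜ := by
    ext μ
    simp [SzlenkBorel.derivDisjoint, derivSubset, Set.preimage_iUnion, Set.compl_iUnion,
      Set.subset_iInter_iff]
  rw [e]
  exact .iInter hξ fun n => h _ (hF n).isOpen_compl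

/-- The formula for the successor step nests nine countable operations, counting the one inside
`derivDisjoint`, and each costs 2. -/
theorem IsDelta0.derivSubset_add_one {ξ : Ordinal.{0}} {β : Ordinal.{0}} (hξ : 2 ≤ ξ)
    (h : ∀ U : Set (V → ℝ), IsOpen U → IsDelta0 ξ (derivSubset ε β U)) {U : Set (V → ℝ)}
    (hU : IsOpen U) : IsDelta0 (ξ + 18) (derivSubset ε (β + 1) U) := by
  have hW (W : TopologicalSpace.countableBasis (V → ℝ)) : IsOpen W.1 :=
    TopologicalSpace.isOpen_of_mem_countableBasis W.2
  have hle (n : Ordinal.{0}) : ξ ≤ ξ + n := le_self_add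
  have h1 (n : Ordinal.{0}) : 1 ≤ ξ + n := (one_le_two.trans hξ).trans (hle n)
  have hadd (m n : ℕ) : ξ + m + n = ξ + (m + n : ℕ) := by rw [add_assoc, Nat.cast_add]
  rw [SzlenkBorel.derivSubset_add_one β hU]
  have e18 : ξ + 18 = ξ + (16 : ℕ) + 2 := (hadd 16 2).symm
  have e16 : ξ + (16 : ℕ) = ξ + (14 : ℕ) + 2 := (hadd 14 2).symm
  have e14 : ξ + (14 : ℕ) = ξ + (12 : ℕ) + 2 := (hadd 12 2).symm
  have e12 : ξ + (12 : ℕ) = ξ + (10 : ℕ) + 2 := (hadd 10 2).symm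
  have e10 : ξ + (10 : ℕ) = ξ + (8 : ℕ) + 2 := (hadd 8 2).symm
  have e8 : ξ + (8 : ℕ) = ξ + (6 : ℕ) + 2 := (hadd 6 2).symm
  have e6 : ξ + (6 : ℕ) = ξ + (4 : ℕ) + 2 := (hadd 4 2).symm
  have e4 : ξ + (4 : ℕ) = ξ + 2 + 2 := (hadd 2 2).symm
  rw [e18]
  refine .iUnion (h1 _) fun s => ?_
  rw [e16]
  refine .inter ((h _ (hU.union (isOpen_biUnion fun W _ => hW W))).mono (hle _)) ?_
  rw [e14]
  refine .iInter (h1 _) fun W => ?_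
  rw [e12]
  refine .iUnion (h1 _) fun δ => ?_
  rw [e10]
  refine .iInter (h1 _) fun v => ?_
  rw [e8]
  refine .union (.of_isOpen (hξ.trans (hle _))
    (isOpen_lt continuous_const (continuous_apply_pseudonorm v))) ?_
  rw [e6]
  refine .iInter (h1 _) fun q => ?_
  rw [e4]
  exact .union
    (.derivDisjoint (one_le_two.trans hξ) h
      ((hW W).inter (isOpen_lt continuous_const (continuous_apply v))))
    (.derivDisjoint (one_le_two.trans hξ) h
      ((hW W).inter (isOpen_lt (continuous_apply v) continuous_const)))

/-! ### Complexity along the transfinite iteration -/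

theorem countable_Iio_of_lt_omega_one {β : Ordinal.{0}} (hβ : β < Ordinal.omega 1) :
    Countable (Set.Iio β) := by
  rw [← Cardinal.mk_le_aleph0_iff, Cardinal.mk_Iio_ordinal, Cardinal.lift_le_aleph0,
    ← Order.lt_succ_iff, Cardinal.succ_aleph0]
  exact Cardinal.lt_omega_iff_card_lt.1 hβ

/-- The finite factor stands on the left so that a successor adds 18, while at a limit `β` all
earlier bounds are at most `18 * β`, leaving room for the 2 levels of the union. -/
theorem isDelta0_derivSubset {β : Ordinal.{0}} (hβ : β < Ordinal.omega 1) {U : Set (V → ℝ)}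
    (hU : IsOpen U) : IsDelta0 ((18 : ℕ) * (β + 1)) (derivSubset ε β U) := by
  have h2 (β : Ordinal.{0}) : 2 ≤ (18 : ℕ) * (β + 1) := by
    refine le_trans (b := ((18 : ℕ) : Ordinal.{0})) (by exact_mod_cast (by simp : 2 ≤ 18)) ?_
    exact le_mul_of_one_le_right (by simp) le_add_self
  induction β using Ordinal.limitRecOn generalizing U with
  | zero =>
    refine .of_isOpen (h2 0) ?_
    simpa only [derivSubset, szlenkIter_zero] using isOpen_setOf_dualBall_subset hU
  | add_one β ih =>
    have h := IsDelta0.derivSubset_add_one (h2 β)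
      (fun U hU => ih ((Order.lt_add_one_iff.2 le_rfl).trans hβ) hU) hU
    rw [mul_add_one ((18 : ℕ) : Ordinal.{0}) (β + 1)]
    exact h
  | limit β hlim ih =>
    have := countable_Iio_of_lt_omega_one hβ
    have e : derivSubset ε β U = ⋃ γ : Set.Iio β, derivSubset ε γ U := by
      ext μ
      simp [derivSubset, szlenkIter_limit_subset_iff isCompact_dualBall hlim
        (hU.preimage (continuous_evalV μ))]
    have h : IsDelta0 ((18 : ℕ) * β + 2) (⋃ γ : Set.Iio β, derivSubset ε γ U) := by
      refine .iUnion ?_ fun γ => (ih γ γ.2 (lt_trans γ.2 hβ) hU).mono ?_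
      · exact (one_le_two.trans (h2 0)).trans
          (mul_le_mul_right (Order.add_one_le_of_lt hlim.bot_lt) _)
      · exact mul_le_mul_right (Order.add_one_le_of_lt γ.2) _
    rw [e]
    refine h.mono ?_
    rw [mul_add_one]
    gcongr
    exact_mod_cast (by simp : 2 ≤ 18)

/-- The set of those `μ` for which the Szlenk index of `X_μ` is at most `ω ^ α` belongs to the
class `𝚷⁰_{ω ^ α + 1}`. -/
theorem isPi0_setOf_szlenkIndex_le {α : Ordinal.{0}} (hα : 1 ≤ α) (hα' : α < Ordinal.omega 1) :
    IsPi0 (Ordinal.omega0 ^ α + 1) {μ : PInfty | szlenkIndex (codedSpace μ.1) ≤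
      ((Ordinal.omega0 ^ α : Ordinal.{0}) : WithTop Ordinal.{0})} := by
  have hα0 : α ≠ 0 := Order.one_le_iff_ne_zero.1 hα
  have hlim : Order.IsSuccLimit (Ordinal.omega0 ^ α) :=
    Ordinal.isSuccLimit_opow_left Ordinal.isSuccLimit_omega0 hα0
  have hlt : Ordinal.omega0 ^ α < Ordinal.omega 1 :=
    Ordinal.isPrincipal_opow_omega 1 Ordinal.omega0_lt_omega_one hα'
  have hmul : ∀ β < Ordinal.omega0 ^ α, (18 : ℕ) * (β + 1) < Ordinal.omega0 ^ α := fun β hβ => by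
    -- Since `ω` divides `ω ^ α`, it absorbs a finite left factor: `18 * ω ^ α = ω ^ α`.
    rw [← Ordinal.mul_omega0_dvd (b := Ordinal.omega0 ^ α) (a := (18 : ℕ)) (by simp)
      (Ordinal.natCast_lt_omega0 18) (by
        simpa using Ordinal.opow_dvd_opow Ordinal.omega0 hα)]
    exact mul_lt_mul_of_pos_left (hlim.add_one_lt hβ) (by simp)
  have hcount := countable_Iio_of_lt_omega_one hlt
  have e : {μ : Pseudonorm | szlenkIndex (codedSpace μ) ≤
      ((Ordinal.omega0 ^ α : Ordinal.{0}) : WithTop Ordinal.{0})}ᶜ =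
      ⋃ n : ℕ, (⋃ β : Set.Iio (Ordinal.omega0 ^ α), derivSubset (1 / (n + 1)) β ∅)ᶜ := by
    rw [← Set.compl_iInter]
    congr 1
    ext μ
    simp [szlenkIndex_le_limit_iff hlim, derivSubset, Set.subset_empty_iff]
  have h : IsSigma0 (Ordinal.omega0 ^ α + 1) {μ : Pseudonorm | szlenkIndex (codedSpace μ) ≤
      ((Ordinal.omega0 ^ α : Ordinal.{0}) : WithTop Ordinal.{0})}ᶜ := by
    have h1 : 1 < Ordinal.omega0 ^ α := by
      simpa using Order.IsSuccLimit.add_one_lt hlim hlim.bot_lt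
    have h2 := Order.lt_add_one_iff.2 (le_refl (Ordinal.omega0 ^ α))
    rw [e]
    refine .iUnion_of_countable (h1.trans h2) fun n => ⟨_, h2, ?_⟩
    rw [compl_compl]
    exact .iUnion_of_countable h1 fun β =>
      ⟨_, hmul β β.2, (isDelta0_derivSubset (lt_trans β.2 hlt) isOpen_empty).2⟩
  exact h.preimage continuous_subtype_val

end SzlenkBorel

end

theorem mainTheorem11 (α : Ordinal.{0}) (hα : 1 ≤ α) (hα' : α < Ordinal.omega 1) :
    SzlenkBorel.IsPi0 (Ordinal.omega0 ^ α + 1)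
      {μ : SzlenkBorel.PInfty |
        SzlenkBorel.szlenkIndex (SzlenkBorel.codedSpace μ.1) ≤
          ((Ordinal.omega0 ^ α : Ordinal.{0}) : WithTop Ordinal.{0})} :=
  SzlenkBorel.isPi0_setOf_szlenkIndex_le hα hα'
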